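/- There is an absolute constant $c>0$ such that the following holds for every unsatisfiable CNF formula $F=D_1\wedge\dots\wedge D_k$ over $n$ Boolean variables and every integer $m\ge 1$. Let $S_F$ be the search problem: given $z\in\{0,1\}^n$, find an index $j$ such that the clause $D_j$ is falsified by $z$. Let $d(F)$ be the least depth of a decision tree (querying single variables of $z$) that solves $S_F$. Let $\mathrm{Ind}_m\colon[m]\times\{0,1\}^m\to\{0,1\}$, $\mathrm{Ind}_m(x,y)=y_x$, and let $S_F\circ\mathrm{Ind}_m^n$ be the two-party search problem: given $x\in[m]^n$ (Alice) and $y\in(\{0,1\}^m)^n$ (Bob), find a solution of $S_F$ on the input $z=(\mathrm{Ind}_m(x_1,y_1),\dots,\mathrm{Ind}_m(x_n,y_n))$. A real protocol is a finite binary tree whose leaves are labeled with outputs and whose every inner node $v$ is labeled with functions $a_v\colon[m]^n\to\mathbb{R}$ and $b_v\colon(\{0,1\}^m)^n\to\mathbb{R}$; on input $(x,y)$ the computation starts at the root, goes left at $v$ if $a_v(x)<b_v(y)$ and right otherwise, and outputs the label of the leaf it reaches; the protocol solves $S_F\circ\mathrm{Ind}_m^n$ if this output is a valid solution on every input. Then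 the least depth $\mathrm{rcc}(S_F\circ\mathrm{Ind}_m^n)$ of a real protocol solving $S_F\circ\mathrm{Ind}_m^n$ satisfies \[ \mathrm{rcc}(S_F\circ\mathrm{Ind}_m^n)\;\ge\;\min\bigl(d(F),\,m^{1/1000}\bigr)\cdot c\log_2 m . \] -/

import Mathlib

namespace RealLifting

/-- A search problem with inputs in `I` and outputs in `O`, given by the set `S x` of the
valid outputs on each input `x`. -/
abbrev SearchProblem (I O : Type) := I → Set O

/-- Every input has a valid output. -/
def SearchProblem.Total {I O : Type} (S : SearchProblem I O) : Prop := ∀ x, (S x).Nonempty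

/-! ### CNF formulas and their falsified-clause search problems -/

/-- A literal over the variables `0, …, n - 1`: the literal `(i, b)` is true under an assignment
`z` iff `z i = b`, so `(i, true)` is the variable itself and `(i, false)` is its negation. -/
abbrev Literal (n : ℕ) := Fin n × Bool

/-- A clause is a finite (possibly empty) disjunction of literals. -/
abbrev Clause (n : ℕ) := Finset (Literal n)

/-- An `n`-variate CNF formula is a finite conjunction of clauses. -/
abbrev CNF (n : ℕ) := List (Clause n)

/-- The assignment `z` satisfies the clause `C`. -/
def Clause.Satisfied {n : ℕ} (C : Clause n) (z : Fin n → Bool) : Prop :=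
  ∃ l ∈ C, z l.1 = l.2

/-- No assignment satisfies all clauses of `F`. -/
def CNF.Unsatisfiable {n : ℕ} (F : CNF n) : Prop :=
  ¬ ∃ z : Fin n → Bool, ∀ C ∈ F, Clause.Satisfied C z

/-- The falsified-clause search problem `S_F`: given an assignment, find (the index of) a clause
of `F` that it falsifies. -/
def CNF.search {n : ℕ} (F : CNF n) : SearchProblem (Fin n → Bool) (Fin F.length) :=
  fun z => {j | ¬ Clause.Satisfied (F.get j) z}

theorem CNF.search_total {n : ℕ} {F : CNF n} (hF : CNF.Unsatisfiable F) :
    (CNF.search F).Total := by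
  intro z
  by_contra h
  refine hF ⟨z, fun C hC => ?_⟩
  obtain ⟨j, rfl⟩ := List.get_of_mem hC
  by_contra hj
  exact h ⟨j, hj⟩

/-! ### Decision trees -/

/-- Decision trees over `n` Boolean variables with outputs in `O`. -/
inductive DecisionTree (n : ℕ) (O : Type) : Type
  | leaf (o : O) : DecisionTree n O
  | query (i : Fin n) (t₀ t₁ : DecisionTree n O) : DecisionTree n O

namespace DecisionTree

variable {n : ℕ} {O : Type}

/-- The output of the tree on the input `z`; at a query of the `i`-th variable, the computation
moves to `t₀` if `z i` is false and to `t₁` if it is true. -/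
def eval : DecisionTree n O → (Fin n → Bool) → O
  | leaf o, _ => o
  | query i t₀ t₁, z => if z i = true then t₁.eval z else t₀.eval z

/-- The largest number of queries on a root-to-leaf path. -/
def depth : DecisionTree n O → ℕ
  | leaf _ => 0
  | query _ t₀ t₁ => max t₀.depth t₁.depth + 1

/-- The tree outputs a valid solution on every input. -/
def Solves (t : DecisionTree n O) (S : SearchProblem (Fin n → Bool) O) : Prop :=
  ∀ z, t.eval z ∈ S z

end DecisionTree

/-- The least depth of a decision tree solving `S`. -/
noncomputable def decisionDepth {n : ℕ} {O : Type} (S : SearchProblem (Fin n → Bool) O) : ℕ :=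
  sInf {k | ∃ t : DecisionTree n O, t.Solves S ∧ t.depth = k}

/-- The decision-tree depth `d(F)` of a CNF formula is that of its search problem. -/
noncomputable def CNF.decisionDepth {n : ℕ} (F : CNF n) : ℕ :=
  RealLifting.decisionDepth (CNF.search F)

/-- Every total search problem is solved by some decision tree, so the infimum in `decisionDepth`
is attained. -/
theorem exists_decisionTree_solves {n : ℕ} {O : Type} {S : SearchProblem (Fin n → Bool) O}
    (hS : S.Total) : ∃ t : DecisionTree n O, t.Solves S := by
  classical
  have key : ∀ Q : Finset (Fin n), ∀ w : Fin n → Bool,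
      ∃ t : DecisionTree n O, ∀ z, (∀ i, i ∉ Q → z i = w i) → t.eval z ∈ S z := by
    intro Q
    induction Q using Finset.induction_on with
    | empty =>
      intro w
      obtain ⟨o, ho⟩ := hS w
      refine ⟨.leaf o, fun z hz => ?_⟩
      have : z = w := funext fun i => hz i (by simp)
      subst this
      exact ho
    | insert a Q ha ih =>
      intro w
      obtain ⟨t₀, h₀⟩ := ih (Function.update w a false)
      obtain ⟨t₁, h₁⟩ := ih (Function.update w a true)
      refine ⟨.query a t₀ t₁, fun z hz => ?_⟩
      have hup : ∀ b, z a = b → ∀ i, i ∉ Q → z i = Function.update w a b i := by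
        intro b hb i hi
        by_cases hia : i = a
        · subst hia; simpa using hb
        · rw [Function.update_of_ne hia]
          exact hz i (by simp [hia, hi])
      by_cases hza : z a = true
      · simpa [DecisionTree.eval, hza] using h₁ z (hup true hza)
      · simpa [DecisionTree.eval, hza] using h₀ z (hup false (by simpa using hza))
  obtain ⟨t, ht⟩ := key Finset.univ (fun _ => false)
  exact ⟨t, fun z => ht z (fun i hi => absurd (Finset.mem_univ i) hi)⟩

/-! ### Real communication protocols -/

/-- Real protocols for inputs in `X × Y` and outputs in `O`. An inner node carries the triangle
`{(x, y) | a x < b y}`, given by a labeling `a` of the rows and a labeling `b` of the columns by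
real numbers. -/
inductive RealProtocol (X Y O : Type) : Type
  | leaf (o : O) : RealProtocol X Y O
  | node (a : X → ℝ) (b : Y → ℝ) (left right : RealProtocol X Y O) : RealProtocol X Y O

namespace RealProtocol

variable {X Y O : Type}

/-- The output on the input `(x, y)`: the computation goes left at an inner node if `(x, y)` lies
in the triangle of that node, and right otherwise. -/
noncomputable def eval : RealProtocol X Y O → X → Y → O
  | leaf o, _, _ => o
  | node a b l r, x, y => if a x < b y then l.eval x y else r.eval x y

/-- The largest number of inner nodes on a root-to-leaf path. -/
def depth : RealProtocol X Y O → ℕ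
  | leaf _ => 0
  | node _ _ l r => max l.depth r.depth + 1

/-- The protocol outputs a valid solution on every input. -/
def Solves (P : RealProtocol X Y O) (S : SearchProblem (X × Y) O) : Prop :=
  ∀ x y, P.eval x y ∈ S (x, y)

end RealProtocol

/-- The least depth of a real protocol solving the bipartite search problem `S`. -/
noncomputable def realCC {X Y O : Type} (S : SearchProblem (X × Y) O) : ℕ :=
  sInf {k | ∃ P : RealProtocol X Y O, P.Solves S ∧ P.depth = k}

/-- Every total bipartite search problem with finitely many inputs is solved by some real protocol,
so the infimum in `realCC` is attained. -/
theorem exists_realProtocol_solves {X Y O : Type} [Finite X] [Finite Y] [Nonempty O]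
    {S : SearchProblem (X × Y) O} (hS : S.Total) : ∃ P : RealProtocol X Y O, P.Solves S := by
  classical
  cases nonempty_fintype X
  cases nonempty_fintype Y
  have keyY : ∀ x₀ : X, ∀ B : Finset Y, ∃ P : RealProtocol X Y O,
      ∀ y ∈ B, P.eval x₀ y ∈ S (x₀, y) := by
    intro x₀ B
    induction B using Finset.induction_on with
    | empty => exact ⟨.leaf (Classical.arbitrary O), by simp⟩
    | insert y₀ B _ ih =>
      obtain ⟨P, hP⟩ := ih
      obtain ⟨o, ho⟩ := hS (x₀, y₀)
      refine ⟨.node (fun _ => 0) (fun y => if y = y₀ then 1 else 0) (.leaf o) P, ?_⟩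
      intro y hy
      by_cases h : y = y₀
      · subst h; simpa [RealProtocol.eval] using ho
      · simpa [RealProtocol.eval, h] using hP y (Finset.mem_of_mem_insert_of_ne hy h)
  have keyX : ∀ A : Finset X, ∃ P : RealProtocol X Y O,
      ∀ x ∈ A, ∀ y, P.eval x y ∈ S (x, y) := by
    intro A
    induction A using Finset.induction_on with
    | empty => exact ⟨.leaf (Classical.arbitrary O), by simp⟩
    | insert x₀ A _ ih =>
      obtain ⟨P, hP⟩ := ih
      obtain ⟨P₀, h₀⟩ := keyY x₀ Finset.univ
      refine ⟨.node (fun x => if x = x₀ then 0 else 1) (fun _ => 1) P₀ P, ?_⟩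
      intro x hx y
      by_cases h : x = x₀
      · subst h; simpa [RealProtocol.eval] using h₀ y (Finset.mem_univ y)
      · simpa [RealProtocol.eval, h] using hP x (Finset.mem_of_mem_insert_of_ne hx h) y
  obtain ⟨P, hP⟩ := keyX Finset.univ
  exact ⟨P, fun x y => hP x (Finset.mem_univ x) y⟩

/-! ### Composition with the index gadget -/

/-- The index gadget `Ind_m : [m] × {0,1}^m → {0,1}`, `(x, y) ↦ y_x`. -/
def ind (m : ℕ) (x : Fin m) (y : Fin m → Bool) : Bool := y x

/-- The composed bipartite search problem `S ∘ Ind_m^n`: Alice holds the `n` pointers, Bob holds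
the `n` strings of length `m`, and the task is to solve `S` on the vector of gadget values. -/
def composeInd {n : ℕ} {O : Type} (S : SearchProblem (Fin n → Bool) O) (m : ℕ) :
    SearchProblem ((Fin n → Fin m) × (Fin n → Fin m → Bool)) O :=
  fun p => S (fun i => ind m (p.1 i) (p.2 i))

end RealLifting

/-! ### Second moment of pattern counts -/

namespace RealLifting

open Finset

/-! A protocol of depth `k` is simulated by a decision tree that follows one path of rectangles `X ×
Y`. With `κ = √m`, the invariant is that the gadgets in a set `A` of queried coordinates have the
answered values, `X` is constant on `A` and `κ`-spread outside `A`, and `Y` is large.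

At a node, halving both sides leaves a rectangle on which the comparison is constant
(`exists_half_rectangle`). Spreadness is restored by passing to a piece of `X₁` fixed on a set `I`
that maximises (size) · `κ ^ #I`; the tree queries `I` and `Y` shrinks to the answers
(`exists_piece`). At a leaf, a free gadget still takes both values on the rectangle, so the named
clause has no literal on a free variable, and the fixed values falsify it (`leaf_mem_search`).

The accounting uses densities: that of `X` in `m ^ #Aᶜ` grows by at least `κ ^ #I / 4` per round and
never exceeds 1, so `κ ^ depth ≤ 4 ^ k`, that is, depth ≤ `4 k / log₂ m`. The density of `Y` drops
by at most `8 κ ^ #I`, a loss that the gain in `X` compensates up to a factor 32 per round.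

The core is `exists_pattern_frequent`: every prescribed outcome on `I` must keep about a `κ ^ (-#I)`
fraction of `Y`. Its proof combines a second moment bound with a colouring of the bits into `r`
independent classes, all of which fail with probability at most `2 ^ (-r)`. -/

theorem card_agree_mul {ι κ : Type*} [Fintype ι] [DecidableEq ι] [Fintype κ] [DecidableEq κ]
    (T : Finset ι) (g : ι → κ) [DecidablePred fun ω : ι → κ => ∀ t ∈ T, ω t = g t] :
    #{ω : ι → κ | ∀ t ∈ T, ω t = g t} * Fintype.card κ ^ #T =
      Fintype.card κ ^ Fintype.card ι := by
  have h : ({ω : ι → κ | ∀ t ∈ T, ω t = g t} : Finset (ι → κ)) =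
      Fintype.piFinset (fun t => if t ∈ T then {g t} else univ) := by
    ext ω
    simp only [mem_filter, mem_univ, true_and, Fintype.mem_piFinset]
    refine forall_congr' fun t => ?_
    by_cases ht : t ∈ T <;> simp [ht]
  have hc : ∀ t, #(if t ∈ T then {g t} else (univ : Finset κ)) =
      if t ∈ T then 1 else Fintype.card κ := by
    intro t; split_ifs <;> simp
  rw [h, Fintype.card_piFinset, prod_congr rfl (fun t _ => hc t), prod_ite]
  simp only [prod_const_one, one_mul, prod_const]
  rw [← pow_add]
  congr 1
  rw [← card_compl_add_card T]
  congr 2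
  ext t; simp

/-- The number of patterns `g j` on `T j` met by `ω`, each weighted by the inverse of its
probability. -/
noncomputable def hits {ι κ J : Type*} [Fintype ι] [DecidableEq ι] [Fintype κ] [DecidableEq κ]
    (s : Finset J) (T : J → Finset ι) (g : J → ι → κ) (ω : ι → κ) : ℝ :=
  ∑ j ∈ s, (Fintype.card κ : ℝ) ^ #(T j) * if ∀ t ∈ T j, ω t = g j t then 1 else 0

section Moments

variable {ι κ J : Type*} [Fintype ι] [DecidableEq ι] [Fintype κ] [DecidableEq κ]
  (s : Finset J) (T : J → Finset ι) (g : J → ι → κ)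

theorem sum_hits : ∑ ω, hits s T g ω = #s * (Fintype.card κ : ℝ) ^ Fintype.card ι := by
  unfold hits
  rw [sum_comm, card_eq_sum_ones, Nat.cast_sum, sum_mul]
  refine sum_congr rfl fun j _ => ?_
  rw [← mul_sum, Nat.cast_one, one_mul, mul_comm]
  simp only [sum_boole]
  exact_mod_cast card_agree_mul (T j) (g j)

/-- Two compatible patterns together fix `T j ∪ T j'`; the weights overcount this by exactly the
intersection. Incompatible patterns contribute 0, hence only an inequality. -/
theorem sum_agree_mul_agree_le (j j' : J) :
    ∑ ω : ι → κ, ((Fintype.card κ : ℝ) ^ #(T j) * if ∀ t ∈ T j, ω t = g j t then 1 else 0) *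
        ((Fintype.card κ : ℝ) ^ #(T j') * if ∀ t ∈ T j', ω t = g j' t then 1 else 0) ≤
      (Fintype.card κ : ℝ) ^ Fintype.card ι * (Fintype.card κ : ℝ) ^ #(T j ∩ T j') := by
  set q : ℝ := (Fintype.card κ : ℝ)
  have h1 := card_agree_mul (T j ∪ T j') (fun t => if t ∈ T j then g j t else g j' t)
  have h2 : #(T j) + #(T j') = #(T j ∪ T j') + #(T j ∩ T j') :=
    (card_union_add_card_inter _ _).symm
  have h3 : ∀ ω : ι → κ, (q ^ #(T j) * if ∀ t ∈ T j, ω t = g j t then 1 else 0) *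
      (q ^ #(T j') * if ∀ t ∈ T j', ω t = g j' t then 1 else 0) ≤
      q ^ (#(T j) + #(T j')) *
        if ∀ t ∈ T j ∪ T j', ω t = if t ∈ T j then g j t else g j' t then 1 else 0 := by
    intro ω
    by_cases ha : ∀ t ∈ T j, ω t = g j t
    · by_cases hb : ∀ t ∈ T j', ω t = g j' t
      · have : ∀ t ∈ T j ∪ T j', ω t = if t ∈ T j then g j t else g j' t := by
          intro t ht
          by_cases h : t ∈ T j
          · simp [h, ha t h]
          · simp [h, hb t ((mem_union.1 ht).resolve_left h)]
        rw [if_pos ha, if_pos hb, if_pos this]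
        simp [pow_add]
      · rw [if_neg hb]
        simp only [mul_zero]
        positivity
    · rw [if_neg ha]
      simp only [mul_zero, zero_mul]
      positivity
  refine (sum_le_sum fun ω _ => h3 ω).trans ?_
  rw [← mul_sum, sum_boole, h2, pow_add]
  have h1' : (#{ω : ι → κ | ∀ t ∈ T j ∪ T j', ω t = if t ∈ T j then g j t else g j' t} : ℝ) *
      q ^ #(T j ∪ T j') = q ^ Fintype.card ι := by simp only [q]; exact_mod_cast h1
  rw [← h1']
  apply le_of_eq
  ring

/-- Second moment of the weighted count of patterns, for a spread family of patterns. -/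
theorem sum_hits_sq_le {η : ℝ} {l : ℕ} (hη : 0 ≤ η) (hT : ∀ j ∈ s, #(T j) ≤ l)
    (hs : ∀ S : Finset ι, (#{j ∈ s | S ⊆ T j} : ℝ) ≤ η ^ #S * #s) :
    ∑ ω, hits s T g ω ^ 2 ≤
      (#s : ℝ) ^ 2 * (1 + Fintype.card κ * η) ^ l * (Fintype.card κ : ℝ) ^ Fintype.card ι := by
  set q : ℝ := (Fintype.card κ : ℝ) with hq
  have hq0 : 0 ≤ q := Nat.cast_nonneg _
  have inner : ∀ j ∈ s, ∑ j' ∈ s, q ^ #(T j ∩ T j') ≤ #s * (1 + q * η) ^ l := by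
    intro j hj
    calc ∑ j' ∈ s, q ^ #(T j ∩ T j')
        -- The single term `S = T j ∩ T j'` is relaxed to all common subsets, so that spreadness
        -- applies for each `S` and the binomial theorem sums the result.
        ≤ ∑ j' ∈ s, ∑ S ∈ (T j).powerset, if S ⊆ T j' then q ^ #S else 0 := by
          refine sum_le_sum fun j' _ => ?_
          rw [← sum_filter]
          exact single_le_sum (f := fun S : Finset ι => q ^ #S) (fun S _ => by positivity)
            (by simp : T j ∩ T j' ∈ ({S ∈ (T j).powerset | S ⊆ T j'} : Finset _))
      _ = ∑ S ∈ (T j).powerset, q ^ #S * #{j' ∈ s | S ⊆ T j'} := by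
          rw [sum_comm]
          refine sum_congr rfl fun S _ => ?_
          rw [← sum_filter, sum_const, nsmul_eq_mul, mul_comm]
      _ ≤ ∑ S ∈ (T j).powerset, q ^ #S * (η ^ #S * #s) :=
          sum_le_sum fun S _ => mul_le_mul_of_nonneg_left (hs S) (by positivity)
      _ = #s * ∑ S ∈ (T j).powerset, (q * η) ^ #S * 1 ^ (#(T j) - #S) := by
          rw [mul_sum]
          refine sum_congr rfl fun S _ => ?_
          rw [mul_pow, one_pow]; ring
      _ = #s * (1 + q * η) ^ #(T j) := by
          rw [sum_pow_mul_eq_add_pow, add_comm]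
      _ ≤ #s * (1 + q * η) ^ l := by
          refine mul_le_mul_of_nonneg_left ?_ (by positivity)
          exact pow_le_pow_right₀ (by linarith [mul_nonneg hq0 hη]) (hT j hj)
  calc ∑ ω, hits s T g ω ^ 2
      = ∑ j ∈ s, ∑ j' ∈ s, ∑ ω : ι → κ,
          (q ^ #(T j) * if ∀ t ∈ T j, ω t = g j t then 1 else 0) *
          (q ^ #(T j') * if ∀ t ∈ T j', ω t = g j' t then 1 else 0) := by
        simp only [hits, sq, sum_mul_sum]
        rw [sum_comm]
        exact sum_congr rfl fun j _ => sum_comm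
    _ ≤ ∑ j ∈ s, ∑ j' ∈ s, q ^ Fintype.card ι * q ^ #(T j ∩ T j') :=
        sum_le_sum fun j _ => sum_le_sum fun j' _ => sum_agree_mul_agree_le T g j j'
    _ = ∑ j ∈ s, q ^ Fintype.card ι * ∑ j' ∈ s, q ^ #(T j ∩ T j') := by simp only [mul_sum]
    _ ≤ ∑ j ∈ s, q ^ Fintype.card ι * (#s * (1 + q * η) ^ l) :=
        sum_le_sum fun j hj => mul_le_mul_of_nonneg_left (inner j hj) (by positivity)
    _ = _ := by rw [sum_const, nsmul_eq_mul]; ring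

/-- Chebyshev: the mean is `#s` and the variance at most `#s ^ 2 / 8`, so a deviation of `#s / 2`
has probability at most `(1 / 8) / (1 / 4) = 1 / 2`. -/
theorem card_hits_lt_le {η : ℝ} {l : ℕ} (hne : s.Nonempty) (hη : 0 ≤ η)
    (hT : ∀ j ∈ s, #(T j) ≤ l)
    (hs : ∀ S : Finset ι, (#{j ∈ s | S ⊆ T j} : ℝ) ≤ η ^ #S * #s)
    (hl : (1 + Fintype.card κ * η) ^ l ≤ 9 / 8) :
    (#{ω : ι → κ | hits s T g ω < #s / 2} : ℝ) ≤
      (Fintype.card κ : ℝ) ^ Fintype.card ι / 2 := by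
  set Q : ℝ := (Fintype.card κ : ℝ) ^ Fintype.card ι with hQ
  have hQ0 : 0 ≤ Q := by positivity
  have hc : (0 : ℝ) < #s := by exact_mod_cast hne.card_pos
  have h1 := sum_hits s T g
  have h2 := (sum_hits_sq_le s T g hη hT hs).trans
    (mul_le_mul_of_nonneg_right (mul_le_mul_of_nonneg_left hl (sq_nonneg _)) hQ0)
  have h3 : ∑ ω : ι → κ, (hits s T g ω - #s) ^ 2 ≤ (#s : ℝ) ^ 2 / 8 * Q := by
    have : ∑ ω : ι → κ, (hits s T g ω - #s) ^ 2 =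
        ∑ ω, hits s T g ω ^ 2 - 2 * #s * ∑ ω, hits s T g ω + (#s : ℝ) ^ 2 * Q := by
      rw [mul_sum, ← sum_sub_distrib]
      have : (#s : ℝ) ^ 2 * Q = ∑ ω : ι → κ, (#s : ℝ) ^ 2 := by
        rw [sum_const, nsmul_eq_mul, card_univ, Fintype.card_fun, hQ]; push_cast; ring
      rw [this, ← sum_add_distrib]
      exact sum_congr rfl fun ω _ => by ring
    rw [this, h1]
    nlinarith
  have h4 : (#{ω : ι → κ | hits s T g ω < #s / 2} : ℝ) * ((#s : ℝ) ^ 2 / 4) ≤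
      ∑ ω : ι → κ, (hits s T g ω - #s) ^ 2 := by
    rw [← nsmul_eq_mul, ← sum_const]
    refine (sum_le_sum fun ω hω => ?_).trans
      (sum_le_sum_of_subset_of_nonneg (filter_subset _ univ) fun ω _ _ => sq_nonneg _)
    have := (mem_filter.1 hω).2
    nlinarith
  have h5 : (#{ω : ι → κ | hits s T g ω < #s / 2} : ℝ) * ((#s : ℝ) ^ 2 / 4) ≤
      Q / 2 * ((#s : ℝ) ^ 2 / 4) := by linarith [h4.trans h3]
  exact le_of_mul_le_mul_right h5 (by positivity)

end Moments

/-! ### Independence of events on disjoint blocks of bits -/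

/-- Exchanging the coordinates outside `A` between two strings is an involution on pairs, and it
matches the pairs counted on the two sides. -/
theorem card_and_mul_card {ι : Type*} [Fintype ι] [DecidableEq ι] (A : Set ι)
    (f g : (ι → Bool) → Prop)
    (hf : ∀ y y', (∀ t ∈ A, y t = y' t) → f y → f y')
    (hg : ∀ y y', (∀ t ∉ A, y t = y' t) → g y → g y')
    [DecidablePred f] [DecidablePred g] :
    #{y | f y ∧ g y} * 2 ^ Fintype.card ι = #{y | f y} * #{y | g y} := by
  classical
  have hu : 2 ^ Fintype.card ι = #(univ : Finset (ι → Bool)) := by simp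
  let mix : (ι → Bool) → (ι → Bool) → ι → Bool := fun a b t => if t ∈ A then a t else b t
  have hmix : ∀ a b, mix (mix a b) (mix b a) = a := by
    intro a b; ext t; by_cases h : t ∈ A <;> simp [mix, h]
  rw [hu, ← card_product, ← card_product]
  refine card_nbij' (fun p => (mix p.1 p.2, mix p.2 p.1)) (fun p => (mix p.1 p.2, mix p.2 p.1))
    ?_ ?_ ?_ ?_
  · rintro ⟨a, b⟩ h
    have h' : f a ∧ g a := by simpa using h
    simp only [coe_product, Set.mem_prod, mem_coe, mem_filter, mem_univ, true_and]
    exact ⟨hf a _ (fun t ht => by simp [mix, ht]) h'.1,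
      hg a _ (fun t ht => by simp [mix, ht]) h'.2⟩
  · rintro ⟨a, b⟩ h
    have h' : f a ∧ g b := by simpa using h
    simp only [coe_product, Set.mem_prod, mem_coe, mem_filter, mem_univ, true_and, and_true]
    exact ⟨hf a _ (fun t ht => by simp [mix, ht]) h'.1,
      hg b _ (fun t ht => by simp [mix, ht]) h'.2⟩
  · rintro ⟨a, b⟩ _; simp [hmix]
  · rintro ⟨a, b⟩ _; simp [hmix]

theorem card_forall_div_eq_prod {ι K : Type*} [Fintype ι] [DecidableEq ι] [DecidableEq K]
    (c : ι → K) (Z : K → (ι → Bool) → Prop) [∀ k, DecidablePred (Z k)]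
    (hZ : ∀ k y y', (∀ t, c t = k → y t = y' t) → Z k y → Z k y') (s : Finset K) :
    (#{y | ∀ k ∈ s, Z k y} : ℝ) / 2 ^ Fintype.card ι =
      ∏ k ∈ s, (#{y | Z k y} : ℝ) / 2 ^ Fintype.card ι := by
  induction s using Finset.induction_on with
  | empty => simp
  | insert a s ha ih =>
    rw [prod_insert ha, ← ih]
    have h := card_and_mul_card {t | c t = a} (Z a) (fun y => ∀ k ∈ s, Z k y)
      (fun y y' h => hZ a y y' h)
      (fun y y' h hy k hk => hZ k y y' (fun t ht => h t (by
        rintro rfl; exact ha (ht ▸ hk))) (hy k hk))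
    have h' : (#{y | ∀ k ∈ insert a s, Z k y} : ℝ) * 2 ^ Fintype.card ι =
        #{y | Z a y} * #{y | ∀ k ∈ s, Z k y} := by
      simp only [forall_mem_insert]
      exact_mod_cast h
    field_simp
    exact h'

/-- A form of AM–GM, obtained by multiplying the inequalities `2 p ≤ exp (2 p - 1)`. -/
theorem prod_le_half_pow {K : Type*} [Fintype K] (p : K → ℝ) (hp : ∀ k, 0 ≤ p k)
    (h : ∑ k, p k ≤ Fintype.card K / 2) : ∏ k, p k ≤ (1 / 2) ^ Fintype.card K := by
  have h1 : ∏ k, 2 * p k ≤ 1 := by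
    calc ∏ k, 2 * p k ≤ ∏ k, Real.exp (2 * p k - 1) :=
          prod_le_prod (fun k _ => by linarith [hp k])
            fun k _ => by linarith [Real.add_one_le_exp (2 * p k - 1)]
      _ = Real.exp (2 * ∑ k, p k - Fintype.card K) := by
          rw [← Real.exp_sum, sum_sub_distrib, mul_sum]; simp
      _ ≤ 1 := Real.exp_le_one_iff.2 (by linarith)
  rw [prod_mul_distrib, prod_const, card_univ] at h1
  rw [one_div, inv_pow, ← one_div, le_div_iff₀ (by positivity), mul_comm]
  exact h1

/-- A large set `Y` of bit strings meets some pattern of a spread family about as often as it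
should: otherwise one can colour the bits so that most colour classes fail to meet the patterns,
independently of each other. -/
theorem exists_pattern_frequent {ι J : Type*} [Fintype ι] [DecidableEq ι] {s : Finset J}
    (hne : s.Nonempty) (T : J → Finset ι) (β : J → ι → Bool) {η : ℝ} {l r : ℕ}
    (hr : 0 < r) (hη : 0 ≤ η) (hT : ∀ j ∈ s, #(T j) ≤ l)
    (hs : ∀ S : Finset ι, (#{j ∈ s | S ⊆ T j} : ℝ) ≤ η ^ #S * #s)
    (hl : (1 + 2 * r * η) ^ l ≤ 9 / 8) (Y : Finset (ι → Bool))
    (hY : 2 * (2 : ℝ) ^ Fintype.card ι ≤ #Y * 2 ^ r) :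
    ∃ j ∈ s, (#Y : ℝ) ≤ 4 * (2 * r) ^ #(T j) * #{y ∈ Y | ∀ t ∈ T j, y t = β j t} := by
  -- Each position carries a colour and a bit. The `k`-th pattern family asks that all of `T j` have
  -- colour `k` and bits `β j`; the alphabet size `2 * r` is the source of the factor in the
  -- conclusion.
  let g : Fin r → J → ι → Fin r × Bool := fun k j t => (k, β j t)
  let e : (ι → Fin r) → (ι → Bool) → ι → Fin r × Bool := fun c y t => (c t, y t)
  let Z : (ι → Fin r) → Fin r → (ι → Bool) → Prop := fun c k y => hits s T (g k) (e c y) < #s / 2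
  classical
  have hq : (Fintype.card (Fin r × Bool) : ℝ) = 2 * r := by simp [mul_comm]
  have hcard : ∀ k, ∑ c, (#{y | Z c k y} : ℝ) ≤ (2 * r) ^ Fintype.card ι / 2 := by
    intro k
    have h := card_hits_lt_le s T (g k) hne hη hT hs (by rw [hq]; exact hl)
    rw [hq] at h
    refine le_trans (le_of_eq ?_) h
    rw [← Nat.cast_sum, ← card_sigma]
    congr 1
    refine card_nbij' (fun p => e p.1 p.2) (fun ω => ⟨fun t => (ω t).1, fun t => (ω t).2⟩)
      ?_ ?_ ?_ ?_
    · rintro ⟨c, y⟩ h; simpa [Z] using h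
    · intro ω h; simpa [Z, e] using h
    · rintro ⟨c, y⟩ _; rfl
    · intro ω _; rfl
  -- Averaging over colourings fixes one for which the colours fail with average probability at most
  -- 1/2.
  obtain ⟨c, hc⟩ : ∃ c : ι → Fin r, ∑ k, (#{y | Z c k y} : ℝ) ≤ r / 2 * 2 ^ Fintype.card ι := by
    by_contra! hcon
    have : Nonempty (Fin r) := ⟨⟨0, hr⟩⟩
    have h1 := sum_lt_sum_of_nonempty (univ_nonempty (α := ι → Fin r)) fun c _ => hcon c
    rw [sum_comm] at h1
    have h2 := h1.trans_le (sum_le_sum fun k _ => hcard k)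
    simp only [sum_const, card_univ, Fintype.card_fun, Fintype.card_fin, nsmul_eq_mul,
      mul_pow, Nat.cast_pow] at h2
    exact h2.ne (by ring)
  -- For fixed `c`, failure of colour `k` depends only on the bits of that colour, so the failures
  -- are independent.
  have hfail : (#{y | ∀ k ∈ univ, Z c k y} : ℝ) ≤ 2 ^ Fintype.card ι * (1 / 2) ^ r := by
    have h1 := card_forall_div_eq_prod c (Z c) (by
      intro k y y' h hy
      refine lt_of_le_of_lt (le_of_eq ?_) hy
      unfold hits
      refine sum_congr rfl fun j _ => ?_
      congr 2
      refine propext (forall₂_congr fun t _ => ?_)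
      by_cases hk : c t = k
      · simp [e, g, h t hk]
      · simp [e, g, hk]) univ
    have h2 := prod_le_half_pow (fun k => (#{y | Z c k y} : ℝ) / 2 ^ Fintype.card ι) (fun k => by positivity)
      (by rw [← sum_div, div_le_iff₀ (by positivity)]; simpa using hc)
    rw [← h1, div_le_iff₀ (by positivity), Fintype.card_fin] at h2
    refine le_trans (le_of_eq ?_) (h2.trans_eq (mul_comm _ _))
    congr!
  by_contra! hcon
  have hc0 : (0 : ℝ) < #s := by exact_mod_cast hne.card_pos
  -- Forgetting the colours only increases the count, so `F y ≥ #s / 2` as soon as one colour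
  -- succeeds. This holds on at least half of `Y`, whereas rarity of every pattern would make the
  -- sum over `Y` smaller than `#s * #Y / 4`.
  let F : (ι → Bool) → ℝ := fun y => ∑ j ∈ s, (2 * r : ℝ) ^ #(T j) *
    if ∀ t ∈ T j, y t = β j t then 1 else 0
  have hF : ∀ y k, ¬ Z c k y → (#s : ℝ) / 2 ≤ F y := by
    intro y k h
    refine (not_lt.1 h).trans ?_
    unfold hits
    refine sum_le_sum fun j _ => ?_
    rw [hq]
    refine mul_le_mul_of_nonneg_left ?_ (by positivity)
    by_cases hj : ∀ t ∈ T j, e c y t = g k j t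
    · rw [if_pos hj, if_pos]
      exact fun t ht => (Prod.ext_iff.1 (hj t ht)).2
    · rw [if_neg hj]; split_ifs <;> norm_num
  have hsum : ∑ y ∈ Y, F y < #s * (#Y / 4) := by
    have : ∑ y ∈ Y, F y = ∑ j ∈ s, (2 * r : ℝ) ^ #(T j) * #{y ∈ Y | ∀ t ∈ T j, y t = β j t} := by
      simp only [F]
      rw [sum_comm]
      refine sum_congr rfl fun j _ => ?_
      rw [← mul_sum, sum_boole]
    rw [this, ← nsmul_eq_mul, ← sum_const]
    refine sum_lt_sum_of_nonempty hne fun j hj => ?_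
    linarith [hcon j hj]
  have hlow : #s / 2 * (#{y ∈ Y | ¬ ∀ k ∈ univ, Z c k y} : ℝ) ≤ ∑ y ∈ Y, F y := by
    rw [mul_comm, ← nsmul_eq_mul, ← sum_const]
    refine (sum_le_sum fun y hy => ?_).trans (sum_le_sum_of_subset_of_nonneg (filter_subset _ Y)
      fun y _ _ => sum_nonneg fun j _ => ?_)
    · have := (mem_filter.1 hy).2
      simp only [not_forall] at this
      obtain ⟨k, -, hk⟩ := this
      exact hF y k hk
    · split_ifs <;> positivity
  have hsplit : (#{y ∈ Y | ∀ k ∈ univ, Z c k y} : ℝ) + #{y ∈ Y | ¬ ∀ k ∈ univ, Z c k y} = #Y := by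
    exact_mod_cast card_filter_add_card_filter_not (s := Y) (fun y => ∀ k ∈ univ, Z c k y)
  have hsub : (#{y ∈ Y | ∀ k ∈ univ, Z c k y} : ℝ) ≤ #{y | ∀ k ∈ univ, Z c k y} := by
    exact_mod_cast card_le_card (filter_subset_filter _ (subset_univ Y))
  have hhalf : (2 : ℝ) ^ Fintype.card ι * (1 / 2) ^ r ≤ #Y / 2 := by
    rw [one_div, inv_pow, ← div_eq_mul_inv, div_le_iff₀ (by positivity)]
    linarith
  nlinarith

end RealLifting

namespace RealLifting

open Finset

/-! ### Monochromatic rectangles of triangles -/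

theorem exists_median {X : Type*} {A : Finset X} (hA : A.Nonempty) (a : X → ℝ) :
    ∃ θ, #A ≤ 2 * #{x ∈ A | a x ≤ θ} ∧ #A ≤ 2 * #{x ∈ A | θ ≤ a x} := by
  classical
  let V : Finset X := {x₀ ∈ A | #A ≤ 2 * #{x ∈ A | a x ≤ a x₀}}
  have hV : V.Nonempty := by
    obtain ⟨x₁, h₁, hmax⟩ := exists_max_image A a hA
    refine ⟨x₁, mem_filter.2 ⟨h₁, ?_⟩⟩
    rw [filter_true_of_mem hmax]
    omega
  obtain ⟨x₀, h₀, hmin⟩ := exists_min_image V a hV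
  refine ⟨a x₀, (mem_filter.1 h₀).2, ?_⟩
  by_contra! hcon
  have hsplit := card_filter_add_card_filter_not (s := A) (fun x => a x₀ ≤ a x)
  have hne : ({x ∈ A | ¬ a x₀ ≤ a x} : Finset X).Nonempty := by
    rw [← card_pos]; omega
  obtain ⟨x₂, h₂, hmax⟩ := exists_max_image _ a hne
  rw [mem_filter] at h₂
  have hsub : ({x ∈ A | ¬ a x₀ ≤ a x} : Finset X) ⊆ {x ∈ A | a x ≤ a x₂} := fun x hx =>
    mem_filter.2 ⟨(mem_filter.1 hx).1, hmax x hx⟩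
  have hle := card_le_card hsub
  exact h₂.2 (hmin x₂ (mem_filter.2 ⟨h₂.1, by omega⟩))

/-- Cut at a median `θ` of the row labels: at least half of the columns lie on one side of `θ`, and
they are paired with the half of the rows on the opposite side. -/
theorem exists_half_rectangle {X Y : Type*} {A : Finset X} (hA : A.Nonempty) (B : Finset Y)
    (a : X → ℝ) (b : Y → ℝ) :
    ∃ A' ⊆ A, ∃ B' ⊆ B, #A ≤ 2 * #A' ∧ #B ≤ 2 * #B' ∧
      ((∀ x ∈ A', ∀ y ∈ B', a x < b y) ∨ ∀ x ∈ A', ∀ y ∈ B', ¬ a x < b y) := by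
  classical
  obtain ⟨θ, h₁, h₂⟩ := exists_median hA a
  have hsplit := card_filter_add_card_filter_not (s := B) (fun y => θ < b y)
  by_cases hB : #B ≤ 2 * #{y ∈ B | θ < b y}
  · refine ⟨_, filter_subset _ _, _, filter_subset _ _, h₁, hB, Or.inl fun x hx y hy => ?_⟩
    exact (mem_filter.1 hx).2.trans_lt (mem_filter.1 hy).2
  · refine ⟨_, filter_subset _ _, {y ∈ B | ¬ θ < b y}, filter_subset _ _, h₂, by omega,
      Or.inr fun x hx y hy => ?_⟩
    exact not_lt.2 ((not_lt.1 (mem_filter.1 hy).2).trans (mem_filter.1 hx).2)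

/-! ### Blockwise spread sets -/

/-- The elements of `R` that agree with `α` on `S`. -/
def cyl {n m : ℕ} (R : Finset (Fin n → Fin m)) (S : Finset (Fin n)) (α : Fin n → Fin m) :
    Finset (Fin n → Fin m) :=
  {x ∈ R | ∀ i ∈ S, x i = α i}

/-- Every restriction of coordinates outside `A` shrinks `X` by a factor of at least `κ` per
coordinate. -/
def Spread {n m : ℕ} (X : Finset (Fin n → Fin m)) (A : Finset (Fin n)) (κ : ℝ) : Prop :=
  ∀ S, Disjoint S A → ∀ α, (#(cyl X S α) : ℝ) * κ ^ #S ≤ #X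

section

variable {n m : ℕ}

theorem mem_cyl {R : Finset (Fin n → Fin m)} {S : Finset (Fin n)} {α x : Fin n → Fin m} :
    x ∈ cyl R S α ↔ x ∈ R ∧ ∀ i ∈ S, x i = α i := mem_filter

theorem cyl_mono {R R' : Finset (Fin n → Fin m)} (h : R ⊆ R') (S : Finset (Fin n))
    (α : Fin n → Fin m) : cyl R S α ⊆ cyl R' S α := filter_subset_filter _ h

theorem spread_univ {κ : ℝ} (hκ : 0 ≤ κ) (hκm : κ ≤ m) :
    Spread (univ : Finset (Fin n → Fin m)) ∅ κ := by
  intro S _ α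
  have h := card_agree_mul S α
  simp only [Fintype.card_fin] at h
  calc (#(cyl univ S α) : ℝ) * κ ^ #S ≤ #(cyl univ S α) * (m : ℝ) ^ #S := by gcongr
    _ = #(univ : Finset (Fin n → Fin m)) := by
      rw [card_univ, Fintype.card_fun, Fintype.card_fin, Fintype.card_fin, cyl]
      exact_mod_cast h

/-- Take a cylinder maximising (size) · `κ ^ #I`. Fixing further coordinates cannot increase this
quantity, which is spreadness; comparison with `I = ∅` gives the size bound. -/
theorem exists_spread_cyl {R : Finset (Fin n → Fin m)} (hR : R.Nonempty) (A : Finset (Fin n))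
    {κ : ℝ} (hκ : 0 < κ) :
    ∃ I α, Disjoint I A ∧ (cyl R I α).Nonempty ∧ (#R : ℝ) ≤ #(cyl R I α) * κ ^ #I ∧
      Spread (cyl R I α) (A ∪ I) κ := by
  have hne : (Aᶜ.powerset ×ˢ R).Nonempty := (powerset_nonempty _).product hR
  obtain ⟨⟨I, α⟩, hp, hmax⟩ := exists_max_image _
    (fun p : Finset (Fin n) × (Fin n → Fin m) => (#(cyl R p.1 p.2) : ℝ) * κ ^ #p.1) hne
  rw [mem_product, mem_powerset, subset_compl_iff_disjoint_right] at hp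
  refine ⟨I, α, hp.1, ⟨α, mem_cyl.2 ⟨hp.2, fun _ _ => rfl⟩⟩, ?_, ?_⟩
  · have := hmax (∅, α) (by simpa using hp.2)
    simpa [cyl] using this
  · intro S hS a
    rw [disjoint_union_right] at hS
    rcases (cyl (cyl R I α) S a).eq_empty_or_nonempty with h | ⟨x, hx⟩
    · simp [h]
    · rw [mem_cyl, mem_cyl] at hx
      have h1 := hmax (I ∪ S, x) (by
        rw [mem_product, mem_powerset, subset_compl_iff_disjoint_right]
        exact ⟨disjoint_union_left.2 ⟨hp.1, hS.1⟩, hx.1.1⟩)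
      have h2 : cyl (cyl R I α) S a ⊆ cyl R (I ∪ S) x := by
        intro w hw
        rw [mem_cyl, mem_cyl] at hw
        refine mem_cyl.2 ⟨hw.1.1, fun i hi => ?_⟩
        rcases mem_union.1 hi with hi | hi
        · rw [hw.1.2 i hi, hx.1.2 i hi]
        · rw [hw.2 i hi, hx.2 i hi]
      have h3 : (#(cyl (cyl R I α) S a) : ℝ) ≤ #(cyl R (I ∪ S) x) := by
        exact_mod_cast card_le_card h2
      simp only at h1
      rw [card_union_of_disjoint hS.2.symm, pow_add] at h1
      refine le_of_mul_le_mul_right ?_ (pow_pos hκ #I)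
      refine le_trans (le_trans (le_of_eq ?_) (mul_le_mul_of_nonneg_right h3
        (by positivity : 0 ≤ κ ^ #I * κ ^ #S))) h1
      ring

theorem card_le_of_eqOn (hm : 0 < m) {X : Finset (Fin n → Fin m)} {A : Finset (Fin n)}
    {α : Fin n → Fin m} (h : ∀ x ∈ X, ∀ i ∈ A, x i = α i) : #X ≤ m ^ #Aᶜ := by
  have h1 := card_agree_mul A α
  rw [Fintype.card_fin, Fintype.card_fin] at h1
  have h2 : #X ≤ #{ω : Fin n → Fin m | ∀ t ∈ A, ω t = α t} :=
    card_le_card fun x hx => mem_filter.2 ⟨mem_univ _, h x hx⟩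
  have h3 : #Aᶜ + #A = n := by simp [card_compl_add_card]
  refine h2.trans (Nat.le_of_mul_le_mul_right ?_ (pow_pos hm #A))
  rw [h1, ← pow_add, h3]

/-- The pattern lemma for the index gadget: for a spread set of pointers, some pointer vector hits
the prescribed gadget values often. -/
theorem exists_pointer_frequent {s : Finset (Fin n → Fin m)} (hne : s.Nonempty)
    {A : Finset (Fin n)} (I : (Fin n → Fin m) → Finset (Fin n))
    (β : (Fin n → Fin m) → Fin n → Bool) {η : ℝ} {l r : ℕ} (hr : 0 < r) (hη : 0 ≤ η)
    (hI : ∀ x ∈ s, #(I x) ≤ l) (hIA : ∀ x ∈ s, Disjoint (I x) A)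
    (hs : ∀ S, Disjoint S A → ∀ α, (#(cyl s S α) : ℝ) ≤ η ^ #S * #s)
    (hl : (1 + 2 * r * η) ^ l ≤ 9 / 8) (Y : Finset (Fin n → Fin m → Bool))
    (hY : 2 * (2 : ℝ) ^ (n * m) ≤ #Y * 2 ^ r) :
    ∃ x ∈ s, (#Y : ℝ) ≤ 4 * (2 * r) ^ #(I x) * #{y ∈ Y | ∀ i ∈ I x, y i (x i) = β x i} := by
  let T : (Fin n → Fin m) → Finset (Fin n × Fin m) := fun x => (I x).image fun i => (i, x i)
  have hT : ∀ x, #(T x) = #(I x) := fun x =>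
    card_image_of_injective _ fun i j h => (Prod.ext_iff.1 h).1
  let e : (Fin n → Fin m → Bool) ↪ (Fin n × Fin m → Bool) := (Equiv.curry _ _ _).symm.toEmbedding
  -- A set of positions read by some pointer vector has at most one position per block, so reading
  -- it amounts to a cylinder condition.
  have hspread : ∀ S : Finset (Fin n × Fin m), (#{x ∈ s | S ⊆ T x} : ℝ) ≤ η ^ #S * #s := by
    intro S
    rcases ({x ∈ s | S ⊆ T x} : Finset _).eq_empty_or_nonempty with h | ⟨α, hα⟩
    · rw [h, card_empty, Nat.cast_zero]; positivity
    · rw [mem_filter] at hα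
      have hval : ∀ x, S ⊆ T x → ∀ p ∈ S, p.1 ∈ I x ∧ p.2 = x p.1 := by
        intro x hx p hp
        obtain ⟨i, hi, rfl⟩ := mem_image.1 (hx hp)
        exact ⟨hi, rfl⟩
      have hcard : #(S.image Prod.fst) = #S := by
        refine card_image_of_injOn fun p hp p' hp' h => Prod.ext h ?_
        rw [(hval α hα.2 p hp).2, (hval α hα.2 p' hp').2, h]
      have hdisj : Disjoint (S.image Prod.fst) A := by
        refine disjoint_of_subset_left ?_ (hIA α hα.1)
        intro i hi
        obtain ⟨p, hp, rfl⟩ := mem_image.1 hi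
        exact (hval α hα.2 p hp).1
      have hsub : ({x ∈ s | S ⊆ T x} : Finset _) ⊆ cyl s (S.image Prod.fst) α := by
        intro x hx
        rw [mem_filter] at hx
        refine mem_cyl.2 ⟨hx.1, fun i hi => ?_⟩
        obtain ⟨p, hp, rfl⟩ := mem_image.1 hi
        rw [← (hval α hα.2 p hp).2, (hval x hx.2 p hp).2]
      calc (#{x ∈ s | S ⊆ T x} : ℝ) ≤ #(cyl s (S.image Prod.fst) α) := by
            exact_mod_cast card_le_card hsub
        _ ≤ η ^ #S * #s := by simpa only [hcard] using hs _ hdisj α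
  obtain ⟨x, hx, h⟩ := exists_pattern_frequent hne T (fun x p => β x p.1) hr hη
    (fun x hx => (hT x).trans_le (hI x hx)) hspread hl (Y.map e) (by simpa using hY)
  refine ⟨x, hx, ?_⟩
  rw [hT, card_map, filter_map, card_map] at h
  refine h.trans (le_of_eq ?_)
  congr 3
  refine filter_congr fun y _ => ?_
  simp [T, e]

/-- A set `X` of pointer vectors that is spread outside `A` has a piece, fixed on a set `I` of
coordinates and spread outside `A ∪ I`, such that every outcome of the gadgets in `I` is
frequent in `Y`. -/
theorem exists_piece {X : Finset (Fin n → Fin m)} (hne : X.Nonempty) {A : Finset (Fin n)}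
    {α₀ : Fin n → Fin m} (hα₀ : ∀ x ∈ X, ∀ i ∈ A, x i = α₀ i) {κ : ℝ} {r : ℕ} (hκ : 2 ≤ κ)
    (hκm : κ ^ 2 = m) (hr : 0 < r) (hrκ : 2 * r ≤ κ)
    (hl : (1 + 2 * r * (4 / κ)) ^ (r + 1) ≤ 9 / 8)
    (hX : ∀ S, Disjoint S A → ∀ α, (#(cyl X S α) : ℝ) * κ ^ #S ≤ 2 * #X)
    (hXm : (m : ℝ) ^ #Aᶜ ≤ #X * 2 ^ r) {Y : Finset (Fin n → Fin m → Bool)}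
    (hY : 2 * (2 : ℝ) ^ (n * m) ≤ #Y * 2 ^ r) :
    ∃ (I : Finset (Fin n)) (α : Fin n → Fin m), ∃ P ⊆ X, Disjoint I A ∧ P.Nonempty ∧ (∀ x ∈ P, ∀ i ∈ I, x i = α i) ∧
      Spread P (A ∪ I) κ ∧ (#X : ℝ) ≤ 2 * (#P * κ ^ #I) ∧
      ∀ β : Fin n → Bool, (#Y : ℝ) ≤ 4 * κ ^ #I * #{y ∈ Y | ∀ i ∈ I, y i (α i) = β i} := by
  classical
  have hκ0 : 0 < κ := by linarith
  have hm : 0 < m := by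
    have : (0 : ℝ) < m := by rw [← hκm]; positivity
    exact_mod_cast this
  have hX0 : (0 : ℝ) < #X := by exact_mod_cast hne.card_pos
  let bad : (Fin n → Fin m) → Prop := fun x => ∃ (I : Finset (Fin n)) (β : Fin n → Bool), #I ≤ r + 1 ∧ Disjoint I A ∧
    4 * (2 * r : ℝ) ^ #I * #{y ∈ Y | ∀ i ∈ I, y i (x i) = β i} < #Y
  -- If half of `X` were bad, the bad part would be spread with `η = 4 / κ`: one factor 2 is the
  -- slack in `hX`, another the halving, and `4 ≤ 4 ^ #S`. The pattern lemma would then find a bad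
  -- pointer that is not bad.
  have hbad : 2 * #{x ∈ X | bad x} < #X := by
    by_contra! hcon
    have hsub : ({x ∈ X | bad x} : Finset _) ⊆ X := filter_subset _ _
    have hex : ∀ x : Fin n → Fin m, ∃ (I : Finset (Fin n)) (β : Fin n → Bool), bad x →
        #I ≤ r + 1 ∧ Disjoint I A ∧
        4 * (2 * r : ℝ) ^ #I * #{y ∈ Y | ∀ i ∈ I, y i (x i) = β i} < #Y := by
      intro x
      by_cases h : bad x
      · obtain ⟨I, β, h⟩ := h; exact ⟨I, β, fun _ => h⟩
      · exact ⟨∅, fun _ => false, fun h' => absurd h' h⟩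
    choose I β hIβ using hex
    obtain ⟨x, hx, h⟩ := exists_pointer_frequent (s := {x ∈ X | bad x}) (A := A)
      (by rw [← card_pos]; have := hne.card_pos; omega) I β hr
      (by positivity : 0 ≤ 4 / κ)
      (fun x hx => (hIβ x (mem_filter.1 hx).2).1) (fun x hx => (hIβ x (mem_filter.1 hx).2).2.1)
      (by
        intro S hS α
        have hcon' : (#X : ℝ) ≤ 2 * #{x ∈ X | bad x} := by exact_mod_cast hcon
        have h1 : (#(cyl {x ∈ X | bad x} S α) : ℝ) ≤ #(cyl X S α) := by
          exact_mod_cast card_le_card (cyl_mono hsub S α)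
        rcases S.eq_empty_or_nonempty with rfl | hSne
        · simp [cyl]
        · have h4 : (4 : ℝ) ≤ 4 ^ #S := by
            have := pow_le_pow_right₀ (by norm_num : (1 : ℝ) ≤ 4) hSne.card_pos
            simpa using this
          rw [div_pow, div_mul_eq_mul_div, le_div_iff₀ (by positivity)]
          calc (#(cyl {x ∈ X | bad x} S α) : ℝ) * κ ^ #S ≤ #(cyl X S α) * κ ^ #S := by gcongr
            _ ≤ 2 * #X := hX S hS α
            _ ≤ 4 * #{x ∈ X | bad x} := by linarith
            _ ≤ _ := by gcongr) hl Y hY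
    exact absurd h (not_le.2 (hIβ x (mem_filter.1 hx).2).2.2)
  have hsplit : #{x ∈ X | bad x} + #{x ∈ X | ¬ bad x} = #X := by
    rw [← card_filter_add_card_filter_not (s := X) bad]
  set R : Finset (Fin n → Fin m) := {x ∈ X | ¬ bad x} with hR
  have hRX : #X ≤ 2 * #R := by omega
  obtain ⟨I, α, hIA, hPne, hcard, hsp⟩ := exists_spread_cyl (R := R)
    (by rw [← card_pos]; have := hne.card_pos; omega) A hκ0
  have hPX : cyl R I α ⊆ X := (filter_subset _ _).trans (filter_subset _ _)
  have hRX' : (#X : ℝ) ≤ 2 * #R := by exact_mod_cast hRX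
  -- Badness only concerns sets of size at most `r + 1`. A larger `I` would push the density of the
  -- cylinder above 1, because `κ ^ #I` cannot exceed the inverse density of `R`, at most `2 ^ (r +
  -- 1)`.
  have hI : #I ≤ r + 1 := by
    have h1 := card_le_of_eqOn hm (X := cyl R I α) (A := A ∪ I)
      (α := fun i => if i ∈ I then α i else α₀ i) (by
        intro x hx i hi
        by_cases h : i ∈ I
        · simp only [h, if_true]; exact (mem_cyl.1 hx).2 i h
        · simp only [h, if_false]
          exact hα₀ x (hPX hx) i ((mem_union.1 hi).resolve_right h))
    have h1' : (#(cyl R I α) : ℝ) ≤ (m : ℝ) ^ #(A ∪ I)ᶜ := by exact_mod_cast h1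
    have h2 : #(A ∪ I)ᶜ + #I = #Aᶜ := by
      have := card_compl_add_card (A ∪ I)
      have := card_compl_add_card A
      have := card_union_of_disjoint hIA.symm
      omega
    have h3 : (#R : ℝ) * κ ^ #I ≤ 2 ^ (r + 1) * #R := by
      calc (#R : ℝ) * κ ^ #I ≤ #(cyl R I α) * κ ^ #I * κ ^ #I := by gcongr
        _ ≤ (m : ℝ) ^ #(A ∪ I)ᶜ * κ ^ #I * κ ^ #I := by gcongr
        _ = (m : ℝ) ^ #Aᶜ := by
          rw [← h2, pow_add, mul_assoc, ← mul_pow, ← sq, hκm]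
        _ ≤ #X * 2 ^ r := hXm
        _ ≤ 2 * #R * 2 ^ r := by gcongr
        _ = _ := by ring
    have h4 : κ ^ #I ≤ 2 ^ (r + 1) := by
      rw [mul_comm] at h3
      exact le_of_mul_le_mul_right h3 (by linarith)
    have h5 : (2 : ℝ) ^ #I ≤ 2 ^ (r + 1) := le_trans (by gcongr) h4
    exact (pow_le_pow_iff_right₀ (by norm_num : (1 : ℝ) < 2)).1 h5
  refine ⟨I, α, cyl R I α, hPX, hIA, hPne, fun x hx => (mem_cyl.1 hx).2, hsp, by linarith, ?_⟩
  intro β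
  obtain ⟨x, hx⟩ := hPne
  have hx' := mem_cyl.1 hx
  have hgood : ¬ bad x := (mem_filter.1 hx'.1).2
  have h1 : (#Y : ℝ) ≤ 4 * (2 * r : ℝ) ^ #I * #{y ∈ Y | ∀ i ∈ I, y i (x i) = β i} := by
    by_contra! h
    exact hgood ⟨I, β, hI, hIA, h⟩
  have h2 : ({y ∈ Y | ∀ i ∈ I, y i (x i) = β i} : Finset _) =
      {y ∈ Y | ∀ i ∈ I, y i (α i) = β i} :=
    filter_congr fun y _ => forall₂_congr fun i hi => by rw [hx'.2 i hi]
  rw [h2] at h1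
  exact h1.trans (by gcongr)

end

end RealLifting

/-! ### Simulation of a real protocol by a decision tree -/

namespace RealLifting

open Finset

/-- Query all variables in `I` and continue with a tree that depends on the answers. -/
theorem exists_query_all {n : ℕ} {O : Type} {d : ℕ} (I : Finset (Fin n)) :
    ∀ t : (Fin n → Bool) → DecisionTree n O, (∀ β, (t β).depth ≤ d) →
      ∃ T : DecisionTree n O, T.depth ≤ #I + d ∧
        ∀ z, ∃ β, (∀ i ∈ I, β i = z i) ∧ T.eval z = (t β).eval z := by
  induction I using Finset.induction_on with
  | empty =>
    intro t ht
    exact ⟨t fun _ => false, by simpa using ht _, fun z => ⟨fun _ => false, by simp, rfl⟩⟩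
  | insert a I ha ih =>
    intro t ht
    have key : ∀ b, ∃ T : DecisionTree n O, T.depth ≤ #I + d ∧ ∀ z, z a = b →
        ∃ β, (∀ i ∈ insert a I, β i = z i) ∧ T.eval z = (t β).eval z := by
      intro b
      obtain ⟨T, hT, h⟩ := ih (fun β => t (Function.update β a b)) fun β => ht _
      refine ⟨T, hT, fun z hz => ?_⟩
      obtain ⟨β, hβ, he⟩ := h z
      refine ⟨_, fun i hi => ?_, he⟩
      by_cases hia : i = a
      · subst hia; simp [hz]
      · rw [Function.update_of_ne hia]
        exact hβ i ((mem_insert.1 hi).resolve_left hia)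
    obtain ⟨T₀, hd₀, h₀⟩ := key false
    obtain ⟨T₁, hd₁, h₁⟩ := key true
    refine ⟨.query a T₀ T₁, ?_, fun z => ?_⟩
    · rw [card_insert_of_notMem ha, DecisionTree.depth]
      omega
    · by_cases hz : z a = true
      · simpa [DecisionTree.eval, hz] using h₁ z hz
      · simpa [DecisionTree.eval, hz] using h₀ z (by simpa using hz)

section

variable {n m : ℕ} {F : CNF n} {κ : ℝ} {r : ℕ}

/-- A leaf of a correct protocol reached by a large spread rectangle names a clause that is
falsified by every assignment compatible with the fixed gadget values. -/
theorem leaf_mem_search (hr : 0 < r) (hκ : 2 ≤ κ)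
    (hl : (1 + 2 * r * (4 / κ)) ^ (r + 1) ≤ 9 / 8) {A : Finset (Fin n)} {ρ : Fin n → Bool}
    {X : Finset (Fin n → Fin m)} {Y : Finset (Fin n → Fin m → Bool)} (hX : X.Nonempty)
    (hfix : ∀ x ∈ X, ∀ y ∈ Y, ∀ i ∈ A, y i (x i) = ρ i) (hsp : Spread X A κ)
    (hY : 2 * (2 : ℝ) ^ (n * m) ≤ #Y * 2 ^ r) {o : Fin F.length}
    (ho : ∀ x ∈ X, ∀ y ∈ Y, o ∈ composeInd (CNF.search F) m (x, y)) {z : Fin n → Bool}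
    (hz : ∀ i ∈ A, z i = ρ i) : o ∈ CNF.search F z := by
  have hκ0 : 0 < κ := by linarith
  have hY0 : (0 : ℝ) < #Y := by
    by_contra! h
    have : (0 : ℝ) < 2 * 2 ^ (n * m) := by positivity
    have : (#Y : ℝ) * 2 ^ r ≤ 0 := mul_nonpos_of_nonpos_of_nonneg h (by positivity)
    linarith
  rintro ⟨⟨i, b⟩, hmem, hib⟩
  suffices h : ∃ x ∈ X, ∃ y ∈ Y, y i (x i) = b by
    obtain ⟨x, hx, y, hy, h⟩ := h
    exact ho x hx y hy ⟨(i, b), hmem, h⟩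
  by_cases hiA : i ∈ A
  · obtain ⟨x, hx⟩ := hX
    obtain ⟨y, hy⟩ := card_pos.1 (by exact_mod_cast hY0 : 0 < #Y)
    exact ⟨x, hx, y, hy, by rw [hfix x hx y hy i hiA, ← hz i hiA]; exact hib⟩
  -- A free gadget attains the value `b` somewhere on the rectangle, and there the clause would be
  -- satisfied. The length bound `r + 1` is used only to match `hl`.
  · obtain ⟨x, hx, h⟩ := exists_pointer_frequent hX (A := A) (fun _ => {i}) (fun _ _ => b) hr
      (by positivity : 0 ≤ 4 / κ) (l := r + 1) (fun _ _ => by simp)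
      (fun _ _ => by simpa using hiA)
      (by
        intro S hS α
        rw [div_pow, div_mul_eq_mul_div, le_div_iff₀ (by positivity)]
        have h4 : (1 : ℝ) ≤ 4 ^ #S := one_le_pow₀ (by norm_num)
        have := hsp S hS α
        have : (#X : ℝ) ≤ 4 ^ #S * #X := le_mul_of_one_le_left (by positivity) h4
        linarith) hl Y hY
    have hpos : ({y ∈ Y | ∀ j ∈ ({i} : Finset (Fin n)), y j (x j) = b} : Finset _).Nonempty := by
      rw [nonempty_iff_ne_empty]
      intro h0
      rw [h0] at h
      simp at h
      rw [h] at hY0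
      simp at hY0
    obtain ⟨y, hy⟩ := hpos
    rw [mem_filter] at hy
    exact ⟨x, hx, y, hy.1, hy.2 i (mem_singleton_self i)⟩

/-- Simulation of a real protocol that is correct on a large rectangle by a decision tree. -/
theorem exists_tree_of_protocol (hr : 0 < r) (hκ : 2 ≤ κ) (hκm : κ ^ 2 = m) (hrκ : 2 * r ≤ κ)
    (hl : (1 + 2 * r * (4 / κ)) ^ (r + 1) ≤ 9 / 8)
    (P : RealProtocol (Fin n → Fin m) (Fin n → Fin m → Bool) (Fin F.length)) :
    ∀ (A : Finset (Fin n)) (ρ : Fin n → Bool) (α₀ : Fin n → Fin m)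
      (X : Finset (Fin n → Fin m)) (Y : Finset (Fin n → Fin m → Bool)), X.Nonempty →
      (∀ x ∈ X, ∀ y ∈ Y, ∀ i ∈ A, y i (x i) = ρ i) → (∀ x ∈ X, ∀ i ∈ A, x i = α₀ i) →
      Spread X A κ →
      (∀ x ∈ X, ∀ y ∈ Y, P.eval x y ∈ composeInd (CNF.search F) m (x, y)) →
      2 * (2 : ℝ) ^ (n * m) * (m : ℝ) ^ #Aᶜ * 32 ^ P.depth ≤ #X * #Y * 2 ^ r →
      ∃ t : DecisionTree n (Fin F.length),
        (∀ z, (∀ i ∈ A, z i = ρ i) → t.eval z ∈ CNF.search F z) ∧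
        κ ^ t.depth * #X ≤ 4 ^ P.depth * (m : ℝ) ^ #Aᶜ := by
  have hκ0 : 0 < κ := by linarith
  have hmR : (0 : ℝ) < m := by rw [← hκm]; positivity
  have hm : 0 < m := by exact_mod_cast hmR
  -- The density of `X` is at most 1, so the bound on the product of densities passes to `Y` alone.
  have hYsize : ∀ {A : Finset (Fin n)} {α₀ : Fin n → Fin m} {X : Finset (Fin n → Fin m)}
      {Y : Finset (Fin n → Fin m → Bool)} {k : ℕ}, (∀ x ∈ X, ∀ i ∈ A, x i = α₀ i) →
      2 * (2 : ℝ) ^ (n * m) * (m : ℝ) ^ #Aᶜ * 32 ^ k ≤ #X * #Y * 2 ^ r →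
      2 * (2 : ℝ) ^ (n * m) * 32 ^ k ≤ #Y * 2 ^ r := by
    intro A α₀ X Y k hα h
    have h1 : (#X : ℝ) ≤ (m : ℝ) ^ #Aᶜ := by exact_mod_cast card_le_of_eqOn hm hα
    have h2 : 2 * (2 : ℝ) ^ (n * m) * 32 ^ k * (m : ℝ) ^ #Aᶜ ≤ #Y * 2 ^ r * (m : ℝ) ^ #Aᶜ := by
      calc _ = 2 * (2 : ℝ) ^ (n * m) * (m : ℝ) ^ #Aᶜ * 32 ^ k := by ring
        _ ≤ #X * #Y * 2 ^ r := h
        _ ≤ (m : ℝ) ^ #Aᶜ * #Y * 2 ^ r := by gcongr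
        _ = _ := by ring
    exact le_of_mul_le_mul_right h2 (by positivity)
  induction P with
  | leaf o =>
    intro A ρ α₀ X Y hX hfix hα hsp hP hsize
    refine ⟨.leaf o, fun z hz => ?_, ?_⟩
    · exact leaf_mem_search hr hκ hl hX hfix hsp
        (by simpa [RealProtocol.depth] using hYsize hα hsize) hP hz
    · have h1 : (#X : ℝ) ≤ (m : ℝ) ^ #Aᶜ := by exact_mod_cast card_le_of_eqOn hm hα
      simpa [DecisionTree.depth, RealProtocol.depth] using h1
  | node a b L R ihL ihR =>
    intro A ρ α₀ X Y hX hfix hα hsp hP hsize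
    obtain ⟨k, hk⟩ : ∃ k, k = max L.depth R.depth := ⟨_, rfl⟩
    have hdepth : (RealProtocol.node a b L R).depth = k + 1 := by rw [hk, RealProtocol.depth]
    rw [hdepth] at hsize ⊢
    obtain ⟨X₁, hX₁, Y₁, hY₁, hXc, hYc, hmono⟩ := exists_half_rectangle hX Y a b
    obtain ⟨Q, hQk, hQ, ihQ⟩ : ∃ Q : RealProtocol (Fin n → Fin m) (Fin n → Fin m → Bool)
        (Fin F.length), Q.depth ≤ k ∧
        (∀ x ∈ X₁, ∀ y ∈ Y₁, Q.eval x y ∈ composeInd (CNF.search F) m (x, y)) ∧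
        ∀ (A : Finset (Fin n)) (ρ : Fin n → Bool) (α₀ : Fin n → Fin m)
          (X : Finset (Fin n → Fin m)) (Y : Finset (Fin n → Fin m → Bool)), X.Nonempty →
          (∀ x ∈ X, ∀ y ∈ Y, ∀ i ∈ A, y i (x i) = ρ i) → (∀ x ∈ X, ∀ i ∈ A, x i = α₀ i) →
          Spread X A κ →
          (∀ x ∈ X, ∀ y ∈ Y, Q.eval x y ∈ composeInd (CNF.search F) m (x, y)) →
          2 * (2 : ℝ) ^ (n * m) * (m : ℝ) ^ #Aᶜ * 32 ^ Q.depth ≤ #X * #Y * 2 ^ r →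
          ∃ t : DecisionTree n (Fin F.length),
            (∀ z, (∀ i ∈ A, z i = ρ i) → t.eval z ∈ CNF.search F z) ∧
            κ ^ t.depth * #X ≤ 4 ^ Q.depth * (m : ℝ) ^ #Aᶜ := by
      rcases hmono with h | h
      · refine ⟨L, hk ▸ le_max_left _ _, fun x hx y hy => ?_, ihL⟩
        simpa [RealProtocol.eval, h x hx y hy] using hP x (hX₁ hx) y (hY₁ hy)
      · refine ⟨R, hk ▸ le_max_right _ _, fun x hx y hy => ?_, ihR⟩
        simpa only [RealProtocol.eval, h x hx y hy, if_false] using hP x (hX₁ hx) y (hY₁ hy)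
    clear ihL ihR hmono
    have hXc' : (#X : ℝ) ≤ 2 * #X₁ := by exact_mod_cast hXc
    have hYc' : (#Y : ℝ) ≤ 2 * #Y₁ := by exact_mod_cast hYc
    have hX₁ne : X₁.Nonempty := by rw [← card_pos]; have := hX.card_pos; omega
    have hX0 : (0 : ℝ) < #X := by exact_mod_cast hX.card_pos
    have h32 : (32 : ℝ) ≤ 32 ^ (k + 1) := by
      rw [pow_succ]
      have : (1 : ℝ) ≤ 32 ^ k := one_le_pow₀ (by norm_num)
      linarith
    have hYr : 2 * (2 : ℝ) ^ (n * m) ≤ #Y₁ * 2 ^ r := by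
      have h1 := hYsize hα hsize
      have h2 : 2 * (2 : ℝ) ^ (n * m) * 2 ≤ 2 * (2 : ℝ) ^ (n * m) * 32 ^ (k + 1) := by
        gcongr; linarith
      have h3 : (#Y : ℝ) * 2 ^ r ≤ 2 * #Y₁ * 2 ^ r := by gcongr
      linarith
    have hYtot : (#Y : ℝ) ≤ 2 ^ (n * m) := by
      have h := card_le_univ Y
      rw [Fintype.card_fun, Fintype.card_fun, Fintype.card_fin, Fintype.card_fin,
        Fintype.card_bool, ← pow_mul, mul_comm] at h
      exact_mod_cast h
    have hXm : (m : ℝ) ^ #Aᶜ ≤ #X₁ * 2 ^ r := by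
      have h1 : (m : ℝ) ^ #Aᶜ * (2 * 2 ^ (n * m)) ≤ #X₁ * 2 ^ r * (2 * 2 ^ (n * m)) := by
        calc (m : ℝ) ^ #Aᶜ * (2 * 2 ^ (n * m))
            ≤ (m : ℝ) ^ #Aᶜ * (2 * 2 ^ (n * m)) * 32 ^ (k + 1) :=
              le_mul_of_one_le_right (by positivity) (by linarith)
          _ = 2 * (2 : ℝ) ^ (n * m) * (m : ℝ) ^ #Aᶜ * 32 ^ (k + 1) := by ring
          _ ≤ #X * #Y * 2 ^ r := hsize
          _ ≤ 2 * #X₁ * 2 ^ (n * m) * 2 ^ r := by gcongr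
          _ = _ := by ring
      exact le_of_mul_le_mul_right h1 (by positivity)
    obtain ⟨I, α, P, hPX, hIA, hPne, hPα, hPsp, hPc, hPY⟩ := exists_piece hX₁ne
      (fun x hx => hα x (hX₁ hx)) hκ hκm hr hrκ hl
      (fun S hS α => (mul_le_mul_of_nonneg_right
        (by exact_mod_cast card_le_card (cyl_mono hX₁ S α)) (by positivity)).trans
        ((hsp S hS α).trans hXc')) hXm hYr
    have hP0 : (0 : ℝ) < #P := by exact_mod_cast hPne.card_pos
    have hcompl : #(A ∪ I)ᶜ + #I = #Aᶜ := by
      have := card_compl_add_card (A ∪ I)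
      have := card_compl_add_card A
      have := card_union_of_disjoint hIA.symm
      omega
    have hmA : (m : ℝ) ^ #Aᶜ = (m : ℝ) ^ #(A ∪ I)ᶜ * (κ ^ #I * κ ^ #I) := by
      rw [← hcompl, pow_add, ← mul_pow, ← sq, hκm]
    have hXP : (#X : ℝ) ≤ 4 * (#P * κ ^ #I) := by linarith
    have hsub : ∀ β : Fin n → Bool, ∃ t : DecisionTree n (Fin F.length),
        (∀ z, (∀ i ∈ A ∪ I, z i = if i ∈ I then β i else ρ i) → t.eval z ∈ CNF.search F z) ∧
        κ ^ t.depth * #P ≤ 4 ^ k * (m : ℝ) ^ #(A ∪ I)ᶜ := by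
      intro β
      obtain ⟨t, ht, hd⟩ := ihQ (A ∪ I) (fun i => if i ∈ I then β i else ρ i)
        (fun i => if i ∈ I then α i else α₀ i) P {y ∈ Y₁ | ∀ i ∈ I, y i (α i) = β i} hPne
        (by
          intro x hx y hy i hi
          rw [mem_filter] at hy
          by_cases h : i ∈ I
          · simp only [h, if_true]
            rw [hPα x hx i h, hy.2 i h]
          · simp only [h, if_false]
            exact hfix x (hX₁ (hPX hx)) y (hY₁ hy.1) i ((mem_union.1 hi).resolve_right h))
        (by
          intro x hx i hi
          by_cases h : i ∈ I
          · simp only [h, if_true]; exact hPα x hx i h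
          · simp only [h, if_false]
            exact hα x (hX₁ (hPX hx)) i ((mem_union.1 hi).resolve_right h))
        hPsp (fun x hx y hy => hQ x (hPX hx) y (mem_filter.1 hy).1)
        (by
          set Y' : Finset (Fin n → Fin m → Bool) := {y ∈ Y₁ | ∀ i ∈ I, y i (α i) = β i}
          -- `32 = 4 * 8`: `X` loses 2 by halving and 2 by discarding bad pointers, `Y` loses 2 by
          -- halving and 4 in the pattern lemma. The two factors `κ ^ #I` make up the `m ^ #I` by
          -- which the ambient space shrinks.
          have h1 : 2 * (2 : ℝ) ^ (n * m) * (m : ℝ) ^ #(A ∪ I)ᶜ * 32 ^ Q.depth *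
              (32 * (κ ^ #I * κ ^ #I)) ≤ #P * #Y' * 2 ^ r * (32 * (κ ^ #I * κ ^ #I)) := by
            calc _ ≤ 2 * (2 : ℝ) ^ (n * m) * (m : ℝ) ^ #(A ∪ I)ᶜ * 32 ^ k *
                  (32 * (κ ^ #I * κ ^ #I)) := by gcongr; norm_num
              _ = 2 * (2 : ℝ) ^ (n * m) * (m : ℝ) ^ #Aᶜ * 32 ^ (k + 1) := by
                rw [hmA]; ring
              _ ≤ #X * #Y * 2 ^ r := hsize
              _ ≤ 4 * (#P * κ ^ #I) * (2 * (4 * κ ^ #I * #Y')) * 2 ^ r := by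
                gcongr
                exact hYc'.trans (by gcongr; exact hPY β)
              _ = _ := by ring
          exact le_of_mul_le_mul_right h1 (by positivity))
      refine ⟨t, ht, hd.trans ?_⟩
      gcongr
      norm_num
    choose t ht hd using hsub
    obtain ⟨β₀, -, hmax⟩ := exists_max_image univ (fun β => (t β).depth)
      (univ_nonempty (α := Fin n → Bool))
    obtain ⟨T, hT, hTe⟩ := exists_query_all I t fun β => hmax β (mem_univ β)
    refine ⟨T, fun z hz => ?_, ?_⟩
    · obtain ⟨β, hβ, he⟩ := hTe z
      rw [he]
      refine ht β z fun i hi => ?_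
      by_cases h : i ∈ I
      · simp only [h, if_true]; exact (hβ i h).symm
      · simp only [h, if_false]; exact hz i ((mem_union.1 hi).resolve_right h)
    -- One factor `κ ^ #I` pays for the queries and the other for the shrinking of `X` to `P`;
    -- together they are `m ^ #I`.
    · calc κ ^ T.depth * #X ≤ κ ^ (#I + (t β₀).depth) * (4 * (#P * κ ^ #I)) := by
            gcongr; linarith
        _ = 4 * (κ ^ #I * κ ^ #I) * (κ ^ (t β₀).depth * #P) := by rw [pow_add]; ring
        _ ≤ 4 * (κ ^ #I * κ ^ #I) * (4 ^ k * (m : ℝ) ^ #(A ∪ I)ᶜ) :=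
          mul_le_mul_of_nonneg_left (hd β₀) (by positivity)
        _ = 4 ^ (k + 1) * (m : ℝ) ^ #Aᶜ := by rw [hmA]; ring

/-- A correct real protocol of depth `k` for `S_F ∘ Ind_m^n` with `m` large compared to `k` yields
a decision tree for `S_F` of depth at most `4 k / log₂ m`. -/
theorem exists_tree_of_solves (hr : 0 < r) (hκ : 2 ≤ κ) (hκm : κ ^ 2 = m) (hrκ : 2 * r ≤ κ)
    (hl : (1 + 2 * r * (4 / κ)) ^ (r + 1) ≤ 9 / 8)
    {P : RealProtocol (Fin n → Fin m) (Fin n → Fin m → Bool) (Fin F.length)}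
    (hP : P.Solves (composeInd (CNF.search F) m)) (hPr : 5 * P.depth + 1 ≤ r) :
    ∃ t : DecisionTree n (Fin F.length), t.Solves (CNF.search F) ∧ κ ^ t.depth ≤ 4 ^ P.depth := by
  have hmR : (0 : ℝ) < m := by rw [← hκm]; positivity
  have hm : 0 < m := by exact_mod_cast hmR
  have : Nonempty (Fin m) := ⟨⟨0, hm⟩⟩
  have hXc : (#(univ : Finset (Fin n → Fin m)) : ℝ) = (m : ℝ) ^ n := by simp
  have hYc : (#(univ : Finset (Fin n → Fin m → Bool)) : ℝ) = 2 ^ (n * m) := by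
    simp [← pow_mul, mul_comm]
  have h32 : 2 * (32 : ℝ) ^ P.depth ≤ 2 ^ r := by
    calc 2 * (32 : ℝ) ^ P.depth = 2 ^ (5 * P.depth + 1) := by rw [pow_succ, pow_mul]; norm_num; ring
      _ ≤ 2 ^ r := pow_le_pow_right₀ (by norm_num) hPr
  obtain ⟨t, ht, hd⟩ := exists_tree_of_protocol hr hκ hκm hrκ hl P ∅ (fun _ => false)
    (fun _ => Classical.arbitrary _) univ univ univ_nonempty (by simp) (by simp)
    (spread_univ (by linarith) (by rw [← hκm]; nlinarith)) (fun x _ y _ => hP x y) (by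
      rw [hXc, hYc, compl_empty, card_univ, Fintype.card_fin]
      calc _ = (m : ℝ) ^ n * 2 ^ (n * m) * (2 * 32 ^ P.depth) := by ring
        _ ≤ _ := by gcongr)
  refine ⟨t, fun z => ht z (by simp), ?_⟩
  rw [hXc, compl_empty, card_univ, Fintype.card_fin] at hd
  exact le_of_mul_le_mul_right hd (by positivity)

end

/-! ### Choice of parameters and the final bound -/

theorem decisionDepth_le {n : ℕ} {O : Type} {S : SearchProblem (Fin n → Bool) O}
    {t : DecisionTree n O} (ht : t.Solves S) : decisionDepth S ≤ t.depth :=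
  Nat.sInf_le ⟨t, ht, rfl⟩

theorem exists_protocol_depth_eq {n m : ℕ} {F : CNF n} (hF : CNF.Unsatisfiable F) :
    ∃ P : RealProtocol (Fin n → Fin m) (Fin n → Fin m → Bool) (Fin F.length),
      P.Solves (composeInd (CNF.search F) m) ∧
        P.depth = realCC (composeInd (CNF.search F) m) := by
  have : Nonempty (Fin F.length) := ⟨(CNF.search_total hF fun _ => false).choose⟩
  obtain ⟨P, hP⟩ := exists_realProtocol_solves (S := composeInd (CNF.search F) m)
    fun p => CNF.search_total hF _
  exact Nat.sInf_mem (s := {k | ∃ P : RealProtocol _ _ _, P.Solves _ ∧ P.depth = k})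
    ⟨P.depth, P, hP, rfl⟩

/-- Constant strings `y i = z i` realise every `z`, so a one-leaf protocol is a one-leaf tree. -/
theorem decisionDepth_eq_zero {n m : ℕ} {F : CNF n} (hm : 0 < m)
    {P : RealProtocol (Fin n → Fin m) (Fin n → Fin m → Bool) (Fin F.length)}
    (hP : P.Solves (composeInd (CNF.search F) m)) (h0 : P.depth = 0) :
    CNF.decisionDepth F = 0 := by
  cases P with
  | leaf o =>
    exact Nat.le_zero.1 (decisionDepth_le (t := .leaf o)
      fun z => hP (fun _ => ⟨0, hm⟩) (fun i _ => z i))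
  | node a b L R => simp [RealProtocol.depth] at h0

-- Here `r = 5 * k + 1`, since the invariant at the root needs `2 * 32 ^ k ≤ 2 ^ r`. With `u = m ^
-- (1 / 1000)` one has `r = O(u ^ 2)` and `√m = u ^ 500`, while the conditions only need `√m` to
-- dominate `r ^ 2`; the exponent leaves ample room.
open Filter in
theorem eventually_parameters :
    ∀ᶠ m : ℕ in atTop, 2 ≤ √(m : ℝ) ∧ ∀ k : ℕ,
      (k : ℝ) ≤ (m : ℝ) ^ ((1 : ℝ) / 1000) * Real.logb 2 m →
        2 * ((5 * k + 1 : ℕ) : ℝ) ≤ √(m : ℝ) ∧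
        (1 + 2 * ((5 * k + 1 : ℕ) : ℝ) * (4 / √(m : ℝ))) ^ (5 * k + 1 + 1) ≤ 9 / 8 := by
  have hlog : ∀ᶠ x : ℝ in atTop, Real.log x ≤ Real.log 2 * x ^ ((1 : ℝ) / 1000) := by
    have h := (isLittleO_log_rpow_atTop (by norm_num : (0 : ℝ) < 1 / 1000)).bound
      (Real.log_pos one_lt_two)
    filter_upwards [h, eventually_ge_atTop 1] with x hx h1
    rw [Real.norm_eq_abs, Real.norm_eq_abs, abs_of_nonneg (Real.log_nonneg h1),
      abs_of_nonneg (by positivity)] at hx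
    exact hx
  have hbig : ∀ᶠ x : ℝ in atTop, (1000000 : ℝ) ≤ x ^ ((1 : ℝ) / 1000) :=
    (tendsto_rpow_atTop (by norm_num)).eventually_ge_atTop _
  filter_upwards [tendsto_natCast_atTop_atTop.eventually hlog,
    tendsto_natCast_atTop_atTop.eventually hbig, eventually_ge_atTop 1] with m hm₁ hm₂ hm₃
  have hm0 : (0 : ℝ) ≤ m := Nat.cast_nonneg m
  obtain ⟨u, hu⟩ : ∃ u : ℝ, u = (m : ℝ) ^ ((1 : ℝ) / 1000) := ⟨_, rfl⟩
  rw [← hu] at hm₁ hm₂ ⊢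
  have hsqrt : √(m : ℝ) = u ^ 500 := by
    rw [hu, ← Real.rpow_natCast, ← Real.rpow_mul hm0, Real.sqrt_eq_rpow]
    norm_num
  have hu6 : u ^ 6 ≤ u ^ 500 := pow_le_pow_right₀ (by linarith) (by norm_num)
  have hu1 : u ≤ u ^ 6 := le_self_pow₀ (by linarith) (by norm_num)
  rw [hsqrt]
  refine ⟨by linarith, fun k hk => ?_⟩
  have hlogb : Real.logb 2 m ≤ u := by
    rw [Real.logb, div_le_iff₀ (Real.log_pos one_lt_two)]
    linarith
  have hk2 : (k : ℝ) ≤ u ^ 2 := by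
    rw [sq]
    exact hk.trans (by gcongr)
  set R : ℝ := ((5 * k + 1 : ℕ) : ℝ) with hR
  have hRk : R = 5 * k + 1 := by rw [hR]; push_cast; ring
  have hR0 : 1 ≤ R := by rw [hRk]; linarith [(Nat.cast_nonneg k : (0 : ℝ) ≤ k)]
  have hRu : R ≤ 6 * u ^ 2 := by nlinarith
  have hpos : 0 < u ^ 500 := by positivity
  have hprod : 2 * R * (4 / u ^ 500) * (R + 1) ≤ 1 / 16 := by
    have h1 : 8 * R * (R + 1) ≤ 1 / 16 * u ^ 500 := by
      have h2 : R * R ≤ 6 * u ^ 2 * (6 * u ^ 2) := by gcongr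
      have h3 : (16 * 16 * 36 : ℝ) ≤ u ^ 2 := by nlinarith
      have h4 : (16 * 16 * 36 : ℝ) * u ^ 4 ≤ u ^ 2 * u ^ 4 := by gcongr
      nlinarith
    have : 2 * R * (4 / u ^ 500) * (R + 1) = 8 * R * (R + 1) / u ^ 500 := by ring
    rw [this, div_le_iff₀ hpos]
    exact h1
  constructor
  · nlinarith [pow_pos (by linarith : 0 < u) 2, pow_pos (by linarith : 0 < u) 4,
      sq_nonneg (u ^ 2), (by ring : u ^ 6 = u ^ 2 * (u ^ 2 * u ^ 2))]
  · calc (1 + 2 * R * (4 / u ^ 500)) ^ (5 * k + 1 + 1)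
        ≤ Real.exp (2 * R * (4 / u ^ 500)) ^ (5 * k + 1 + 1) := by
          gcongr
          linarith [Real.add_one_le_exp (2 * R * (4 / u ^ 500))]
      _ = Real.exp (2 * R * (4 / u ^ 500) * (R + 1)) := by
          rw [← Real.exp_nat_mul, hR]
          push_cast
          ring_nf
      _ ≤ Real.exp (1 / 16) := Real.exp_le_exp.2 hprod
      _ ≤ 9 / 8 := by
          have h := Real.one_sub_le_exp_neg (1 / 16)
          rw [Real.exp_neg] at h
          have hp := Real.exp_pos (1 / 16)
          have : Real.exp (1 / 16) * (15 / 16) ≤ 1 := by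
            calc Real.exp (1 / 16) * (15 / 16) ≤ Real.exp (1 / 16) * (Real.exp (1 / 16))⁻¹ := by
                  gcongr; linarith
              _ = 1 := mul_inv_cancel₀ hp.ne'
          linarith

end RealLifting

theorem theorem7 :
    ∃ c : ℝ, 0 < c ∧
      ∀ (n : ℕ) (F : RealLifting.CNF n), RealLifting.CNF.Unsatisfiable F →
        ∀ m : ℕ, 1 ≤ m →
          min (RealLifting.CNF.decisionDepth F : ℝ) ((m : ℝ) ^ ((1 : ℝ) / 1000)) *
              (c * Real.logb 2 (m : ℝ)) ≤
            (RealLifting.realCC (RealLifting.composeInd (RealLifting.CNF.search F) m) : ℝ) := by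
  obtain ⟨M, hM⟩ := Filter.eventually_atTop.1 RealLifting.eventually_parameters
  have hM0 : (0 : ℝ) ≤ M := Nat.cast_nonneg M
  -- `B` makes the bound at most 1 for `m < M`, which suffices once the depth is positive; `B ≥ 4`
  -- absorbs the constant of the simulation.
  obtain ⟨B, hB, hB0⟩ : ∃ B : ℝ, (∀ m : ℕ, 1 ≤ m → m < M →
      (m : ℝ) ^ ((1 : ℝ) / 1000) * Real.logb 2 m ≤ B) ∧ 4 ≤ B := by
    refine ⟨max 4 ((M : ℝ) ^ ((1 : ℝ) / 1000) * Real.logb 2 M), fun m h1 h2 => ?_,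
      le_max_left _ _⟩
    have h1' : (1 : ℝ) ≤ m := by exact_mod_cast h1
    have h2' : (m : ℝ) ≤ M := by exact_mod_cast h2.le
    refine le_trans ?_ (le_max_right _ _)
    have : 0 ≤ Real.logb 2 m := Real.logb_nonneg one_lt_two h1'
    have : Real.logb 2 m ≤ Real.logb 2 M :=
      Real.logb_le_logb_of_le one_lt_two (by linarith) h2'
    gcongr
  refine ⟨1 / B, by positivity, fun n F hF m hm => ?_⟩
  obtain ⟨P, hP, hPd⟩ := RealLifting.exists_protocol_depth_eq (m := m) hF
  rw [← hPd]
  have hm1 : (1 : ℝ) ≤ m := by exact_mod_cast hm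
  have hlog : 0 ≤ Real.logb 2 (m : ℝ) := Real.logb_nonneg one_lt_two hm1
  have hpow : 0 ≤ (m : ℝ) ^ ((1 : ℝ) / 1000) := by positivity
  have hBpos : 0 < B := by linarith
  rcases Nat.eq_zero_or_pos P.depth with h0 | hpos
  · rw [RealLifting.decisionDepth_eq_zero hm hP h0, h0, Nat.cast_zero, min_eq_left hpow, zero_mul]
  have hpos' : (1 : ℝ) ≤ P.depth := by exact_mod_cast hpos
  have hmin : min (RealLifting.CNF.decisionDepth F : ℝ) ((m : ℝ) ^ ((1 : ℝ) / 1000)) *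
      (1 / B * Real.logb 2 (m : ℝ)) ≤ (m : ℝ) ^ ((1 : ℝ) / 1000) * Real.logb 2 m / B := by
    calc _ ≤ (m : ℝ) ^ ((1 : ℝ) / 1000) * (1 / B * Real.logb 2 (m : ℝ)) := by
          gcongr; exact min_le_right _ _
      _ = _ := by ring
  by_cases hmM : m < M
  · refine hmin.trans (le_trans ?_ hpos')
    rw [div_le_one hBpos]
    exact hB m hm hmM
  by_cases hk : (P.depth : ℝ) ≤ (m : ℝ) ^ ((1 : ℝ) / 1000) * Real.logb 2 m
  · obtain ⟨hκ, hpar⟩ := hM m (not_lt.1 hmM)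
    obtain ⟨hrκ, hl⟩ := hpar P.depth hk
    obtain ⟨t, ht, hd⟩ := RealLifting.exists_tree_of_solves (Nat.succ_pos _) hκ
      (Real.sq_sqrt (by linarith)) hrκ hl hP le_rfl
    have hle : (RealLifting.CNF.decisionDepth F : ℝ) ≤ t.depth := by
      exact_mod_cast RealLifting.decisionDepth_le ht
    have hlogd : (t.depth : ℝ) * Real.logb 2 m ≤ 4 * P.depth := by
      have h1 := Real.logb_le_logb_of_le one_lt_two (by positivity) hd
      have h4 : Real.logb 2 4 = 2 := by
        rw [show (4 : ℝ) = 2 ^ (2 : ℝ) by norm_num]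
        exact Real.logb_rpow (by norm_num) (by norm_num)
      rw [Real.logb_pow, Real.logb_pow, h4, Real.sqrt_eq_rpow,
        Real.logb_rpow_eq_mul_logb_of_pos (by linarith)] at h1
      linarith
    calc _ ≤ (t.depth : ℝ) * (1 / B * Real.logb 2 (m : ℝ)) := by
          gcongr; exact (min_le_left _ _).trans hle
      _ = (t.depth : ℝ) * Real.logb 2 m / B := by ring
      _ ≤ P.depth := by
        rw [div_le_iff₀ hBpos]
        nlinarith
  -- A protocol too deep to be simulated already exceeds the bound, thanks to the cap `m ^ (1 /
  -- 1000)` in the minimum.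
  · refine hmin.trans (le_trans (div_le_self (by positivity) (by linarith)) (not_le.1 hk).le)
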